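/- **Machines.** A probabilistic Turing machine (PTM) has a finite set $Q$ of internal states, a finite input alphabet $\Sigma$, a finite work tape alphabet $\Gamma$ containing a blank, a read-only input tape containing $¢\,w\,\$$ for the input $w\in\Sigma^*$, and one two-way infinite, initially blank work tape. When it scans $\sigma\in\Sigma\cup\{¢,\$\}$ on the input tape and $\gamma\in\Gamma$ on the work tape in state $q$, it moves to state $q'$, moves the input head according to $d_i$, writes $\gamma'$ and moves the work head according to $d_w$ ($d_i,d_w\in\{\text{left},\text{right},\text{stationary}\}$) with probability $\delta(q,\sigma,\gamma,q',d_i,\gamma',d_w)$; these probabilities sum to $1$ for each $(q,\sigma,\gamma)$, and each of them is a real number that a deterministic algorithm can approximate to within $2^{-n}$ in time polynomial in $n$. The input head starts on $¢$ and never leaves the region delimited by the end-markers. The machine is *one-way* if its input head never moves left. It *uses space* $s$ if, on every input of length $n$, at most $s(n)$ work tape cells are ever visited with nonzero probability by the work head (the initial cell counts as visited). There is no bound on the running time, and computations need not halt. In a *standard* PTM the states are partitioned into continuing, accepting and rejecting states; the computation terminates when an accepting or rejecting state is entered. In a *PTM with postselection* the states are partitioned into continuing, postselection accept, postselection reject and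 nonpostselection halting states; the computation terminates when a state of one of the last three kinds is entered. If $p^a(w)$ and $p^r(w)$ denote the probabilities of reaching a postselection accept and a postselection reject state on input $w$, it is required that $p^a(w)+p^r(w)>0$ for every $w$, and the acceptance and rejection probabilities of $w$ are defined as $\frac{p^a(w)}{p^a(w)+p^r(w)}$ and $\frac{p^r(w)}{p^a(w)+p^r(w)}$. A machine *recognizes* $L\subseteq\Sigma^*$ *with bounded error* if there is $\epsilon$ with $0\le\epsilon<\frac12$ such that every $w\in L$ is accepted with probability at least $1-\epsilon$ and every $w\in\Sigma^*\setminus L$ is rejected with probability at least $1-\epsilon$. For $s:\mathbb N\to\mathbb N$ let $\mathsf{1BP}_\Sigma(s)$ and $\mathsf{Post1BP}_\Sigma(s)$ be the classes of languages over $\Sigma$ recognized with bounded error by standard one-way PTMs, and by one-way PTMs with postselection, respectively, using space $s$. **Theorem.** One-way PTMs with postselection that use $o(\log\log n)$ space are strictly more powerful than standard one-way PTMs with that space bound. Precisely, for every finite alphabet $\Sigma$: 1. $\displaystyle\bigcup_{s=o(\log\log n)}\mathsf{1BP}_\Sigma(s)\subseteq\bigcup_{s=o(\log\log n)}\mathsf{Post1BP}_\Sigma(s)$,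 and the inclusion is proper if $|\Sigma|\ge 2$; 2. for every single $s:\mathbb N\to\mathbb N$ with $s(n)=o(\log\log n)$ and $s(n)\ge1$ for all $n$, $\mathsf{1BP}_\Sigma(s)\subseteq\mathsf{Post1BP}_\Sigma(s)$, and the inclusion is proper if $|\Sigma|\ge2$. -/

import Mathlib

/-!
# Space-bounded probabilistic Turing machines, with and without postselection

A machine has a read-only input tape holding `¢ w $`, one read/write work tape, and a probabilistic
transition function with efficiently computable probabilities.
-/

noncomputable section

/-- `p` is a real number for which some deterministic algorithm computes, from `n` (in unary), an
approximation of `p` to within `2⁻ⁿ` in time polynomial in `n`.  The approximation has the form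
`± f n / 2ⁿ`, with `f n` written in binary and the fixed sign that of `p`. -/
def IsPolyTimeComputableReal (p : ℝ) : Prop :=
  ∃ f : ℕ → ℕ,
    Nonempty (Turing.TM2ComputableInPolyTime
      Computability.unaryEncodeNat Computability.encodeNat f) ∧
    ∀ n : ℕ, |(f n : ℝ) / 2 ^ n - (|p|)| ≤ 1 / 2 ^ n

/-- Head movements. -/
inductive HeadMove : Type
  | left
  | right
  | stationary

/-- Symbols on the input tape: letters and the two end-markers. -/
inductive InputSym (A : Type) : Type
  | cent
  | letter (a : A)
  | dollar

/-- The halting outcomes of a standard machine. -/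
inductive StdHalt : Type
  | accept
  | reject

/-- The halting outcomes of a machine with postselection: postselection accept, postselection
reject, and nonpostselection halting. -/
inductive PostHalt : Type
  | accept
  | reject
  | nonpost

/-- A probabilistic Turing machine with input alphabet `A` and set of halting outcomes `H`.
`outcome q = none` says that `q` is a continuing state, and `outcome q = some h` that `q` is a
halting state with outcome `h`; so `outcome` is the partition of the states by move outcomes.
`δ q σ γ` is the probability distribution of (new state, input head move, symbol written,
work head move) when the machine scans `σ` on the input tape and `γ` on the work tape. -/
structure PTM (A H : Type) where
  /-- internal states -/
  Q : Type
  /-- work tape alphabet -/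
  Γ : Type
  [finQ : Finite Q]
  [finΓ : Finite Γ]
  /-- blank work tape symbol -/
  blank : Γ
  /-- initial state -/
  start : Q
  /-- partition of the states -/
  outcome : Q → Option H
  /-- transition probabilities -/
  δ : Q → InputSym A → Γ → PMF (Q × HeadMove × Γ × HeadMove)
  /-- all transition probabilities are efficiently computable reals -/
  computable : ∀ q σ γ x, IsPolyTimeComputableReal (δ q σ γ x).toReal
  /-- the input head never moves left of `¢` -/
  cent_not_left : ∀ q γ q' γ' d, δ q InputSym.cent γ (q', HeadMove.left, γ', d) = 0
  /-- the input head never moves right of `$` -/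
  dollar_not_right : ∀ q γ q' γ' d, δ q InputSym.dollar γ (q', HeadMove.right, γ', d) = 0

namespace PTM

/-- A configuration: state, head positions, and work tape contents.  Input position `0` is `¢`,
positions `1, …, |w|` are the letters of `w`, and position `|w| + 1` is `$`. -/
structure Config (Q Γ : Type) where
  /-- internal state -/
  state : Q
  /-- input head position -/
  inPos : ℕ
  /-- work head position -/
  workPos : ℤ
  /-- work tape contents -/
  tape : ℤ → Γ

/-- The symbol in cell `i` of the input tape `¢ w $`. -/
def inputAt {A : Type} (w : List A) : ℕ → InputSym A
  | 0 => InputSym.cent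
  | i + 1 =>
    match w[i]? with
    | some a => InputSym.letter a
    | none => InputSym.dollar

/-- The new input head position. -/
def moveIn : HeadMove → ℕ → ℕ
  | HeadMove.left, i => i - 1
  | HeadMove.right, i => i + 1
  | HeadMove.stationary, i => i

/-- The new work head position. -/
def moveWork : HeadMove → ℤ → ℤ
  | HeadMove.left, i => i - 1
  | HeadMove.right, i => i + 1
  | HeadMove.stationary, i => i

variable {A H : Type}

/-- The initial configuration: initial state, input head on `¢`, blank work tape. -/
def init (M : PTM A H) : Config M.Q M.Γ where
  state := M.start
  inPos := 0
  workPos := 0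
  tape := fun _ => M.blank

/-- The configuration that results from carrying out one chosen move. -/
def applyMove (M : PTM A H) (c : Config M.Q M.Γ) (x : M.Q × HeadMove × M.Γ × HeadMove) :
    Config M.Q M.Γ where
  state := x.1
  inPos := moveIn x.2.1 c.inPos
  workPos := moveWork x.2.2.2 c.workPos
  tape := Function.update c.tape c.workPos x.2.2.1

/-- One step on input `w`; in a halting state the computation is terminated. -/
def step (M : PTM A H) (w : List A) (c : Config M.Q M.Γ) : PMF (Config M.Q M.Γ) :=
  match M.outcome c.state with
  | some _ => PMF.pure c
  | none => (M.δ c.state (inputAt w c.inPos) (c.tape c.workPos)).map (M.applyMove c)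

/-- The distribution of the configuration after `t` steps from `c` on input `w`. -/
def run (M : PTM A H) (w : List A) : ℕ → Config M.Q M.Γ → PMF (Config M.Q M.Γ)
  | 0, c => PMF.pure c
  | t + 1, c => (M.step w c).bind (run M w t)

/-- The probability that `M`, on input `w`, ever halts with outcome `h`: the supremum over `t` of
the (nondecreasing) probabilities of having halted with outcome `h` within `t` steps. -/
def haltProb (M : PTM A H) (w : List A) (h : H) : ℝ :=
  (⨆ t : ℕ, (M.run w t M.init).toOuterMeasure {c | M.outcome c.state = some h}).toReal

/-- The work tape cells visited with nonzero probability by `M` on input `w`. -/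
def visitedCells (M : PTM A H) (w : List A) : Set ℤ :=
  {z | ∃ t : ℕ, ∃ c ∈ (M.run w t M.init).support, c.workPos = z}

/-- `M` uses space at most `s`, as a function of the input length. -/
def UsesSpace (M : PTM A H) (s : ℕ → ℕ) : Prop :=
  ∀ w : List A, (M.visitedCells w).encard ≤ s w.length

/-- The input head never moves left. -/
def IsOneWay (M : PTM A H) : Prop :=
  ∀ q σ γ q' γ' d, M.δ q σ γ (q', HeadMove.left, γ', d) = 0

/-- The requirement on machines with postselection: on every input, the machine halts in a
postselection accept or reject state with nonzero probability. -/
def IsPostselecting (M : PTM A PostHalt) : Prop :=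
  ∀ w : List A, 0 < M.haltProb w PostHalt.accept + M.haltProb w PostHalt.reject

/-- Acceptance probability of a machine with postselection. -/
def postAcceptProb (M : PTM A PostHalt) (w : List A) : ℝ :=
  M.haltProb w PostHalt.accept / (M.haltProb w PostHalt.accept + M.haltProb w PostHalt.reject)

/-- Rejection probability of a machine with postselection. -/
def postRejectProb (M : PTM A PostHalt) (w : List A) : ℝ :=
  M.haltProb w PostHalt.reject / (M.haltProb w PostHalt.accept + M.haltProb w PostHalt.reject)

end PTM

/-- Recognition of `L` with two-sided bounded error, in terms of the acceptance and rejection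
probabilities of a machine on each input. -/
def RecognizesBoundedError {A : Type} (acc rej : List A → ℝ) (L : Language A) : Prop :=
  ∃ ε : ℝ, 0 ≤ ε ∧ ε < 1 / 2 ∧ (∀ w ∈ L, 1 - ε ≤ acc w) ∧ (∀ w ∉ L, 1 - ε ≤ rej w)

/-- Languages over `A` recognized with bounded error by standard one-way PTMs using space `s`. -/
def OneWayBPSPACE (A : Type) (s : ℕ → ℕ) : Set (Language A) :=
  {L | ∃ M : PTM A StdHalt, M.IsOneWay ∧ M.UsesSpace s ∧
    RecognizesBoundedError (fun w => M.haltProb w StdHalt.accept)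
      (fun w => M.haltProb w StdHalt.reject) L}

/-- Languages over `A` recognized with bounded error by one-way PTMs with postselection using
space `s`. -/
def PostOneWayBPSPACE (A : Type) (s : ℕ → ℕ) : Set (Language A) :=
  {L | ∃ M : PTM A PostHalt, M.IsPostselecting ∧ M.IsOneWay ∧ M.UsesSpace s ∧
    RecognizesBoundedError M.postAcceptProb M.postRejectProb L}

/-- `s(n) = o(log log n)`. -/
def IsLittleOLogLog (s : ℕ → ℕ) : Prop :=
  (fun n => (s n : ℝ)) =o[Filter.atTop] (fun n : ℕ => Real.log (Real.log n))

/-- Languages over `A` recognized with bounded error by standard one-way PTMs that use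
`o(log log n)` space. -/
def OneWayBPSPACELittleOLogLog (A : Type) : Set (Language A) :=
  {L | ∃ s : ℕ → ℕ, IsLittleOLogLog s ∧ L ∈ OneWayBPSPACE A s}

/-- Languages over `A` recognized with bounded error by one-way PTMs with postselection that use
`o(log log n)` space. -/
def PostOneWayBPSPACELittleOLogLog (A : Type) : Set (Language A) :=
  {L | ∃ s : ℕ → ℕ, IsLittleOLogLog s ∧ L ∈ PostOneWayBPSPACE A s}

end

/-!
A standard one-way machine becomes a machine with postselection by renaming its outcomes
(`oneWayBPSPACE_subset_postOneWayBPSPACE`). For properness the witness is the language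
`equalCounts a b` of the words in which two fixed letters `a ≠ b` occur equally often.

With postselection this language needs no work tape at all. Let `m` and `n` be the two letter
counts. A finite automaton can survive its input with probability `x * y`, or with probability
`x ^ 2`, or with probability `y ^ 2`, where `x = 8⁻ᵐ` and `y = 8⁻ⁿ`: it risks its life at each
occurrence of a letter that matters to the branch chosen at the start. Survivors of the first
branch accept, survivors of the other two reject, and everything else is discarded. If `m = n` the
three numbers agree, and otherwise `x ^ 2 + y ^ 2` exceeds `8 * (x * y)`; so suitable weights for
the branches give bounded error (`equalCounts_mem_postOneWayBPSPACE`). The automaton throws a die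
with `64` sides in every step, so all its transition probabilities are `0` or `1 / 64`, which are
shown to be polynomial-time computable by explicit stack machines.

For standard machines there is a counting argument in the style of Rabin's theorem on isolated
cutpoints. Past a prefix `u`, a one-way machine retains only its state, its work tape and its work
head position. Hence, up to an arbitrarily small error, the acceptance probability of `u ++ v` is
the scalar product of a vector in `[0, 1] ^ K` that depends on `u` and a vector in `[0, 1] ^ K`
that depends on `v` (`PTM.exists_profile` and `PTM.IsOneWay.value_append_congr`), where `K - 1` is
the number of work configurations. Bounded error forces the vectors of prefixes that have to be
distinguished to be far apart, so the number of such prefixes is at most the number of points of a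
grid in the cube, roughly `K ^ K` (`card_le_of_separated`, `PTM.IsOneWay.card_le`). With
`o(log log n)` space, `K` is `(log n) ^ o(1)`, so `K ^ K` is `n ^ o(1)` (`exists_lt_of_isLittleOLogLog`),
whereas `equalCounts a b` has `N` prefixes of length `N` that have to be distinguished by
continuations of length `N` (`equalCounts_notMem_oneWayBPSPACE`).
-/

noncomputable section

open scoped ENNReal

/-! ### Polynomial-time computable reals -/

section

open Turing Computability

/-- A list of `n` ones is the unary encoding of `n`, and the binary encoding of `2 ^ n - 1`. -/
theorem encodeNat_two_pow_sub_one (n : ℕ) : encodeNat (2 ^ n - 1) = unaryEncodeNat n := by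
  have encodeNat_bit1 (m : ℕ) : encodeNat (2 * m + 1) = true :: encodeNat m := by
    have h : ((2 * m + 1 : ℕ) : Num) = Num.bit1 (m : Num) := by
      rw [← Num.bit1_of_bit1, two_mul]
      push_cast
      rfl
    unfold encodeNat
    rw [h]
    cases (m : Num) <;> rfl
  induction n with
  | zero => rfl
  | succ n ih =>
    have h : 2 ^ (n + 1) - 1 = 2 * (2 ^ n - 1) + 1 := by
      have := Nat.one_le_two_pow (n := n)
      omega
    rw [h, encodeNat_bit1, ih]
    rfl

/-- The statement that pops `k` symbols from the only stack of a machine, and halts. -/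
def popStmt : ℕ → TM2.Stmt (fun _ : Unit => Bool) Unit Unit
  | 0 => TM2.Stmt.halt
  | k + 1 => TM2.Stmt.pop () (fun _ _ => ()) (popStmt k)

/-- A machine with one stack, from which it pops `k` symbols. -/
def popMachine (k : ℕ) : FinTM2 where
  K := Unit
  k₀ := ()
  k₁ := ()
  Γ _ := Bool
  Λ := Unit
  main := ()
  σ := Unit
  initialState := ()
  m _ := popStmt k

theorem stepAux_popStmt (k : ℕ) (l : List Bool) :
    TM2.stepAux (popStmt k) () (fun _ => l) = ⟨none, (), fun _ => l.drop k⟩ := by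
  induction k generalizing l with
  | zero => rfl
  | succ k ih =>
    have h : Function.update (fun _ : Unit => l) () l.tail = fun _ => l.tail := by
      funext u
      simp
    rw [popStmt, TM2.stepAux, h, ih]
    simp

theorem drop_unaryEncodeNat (k n : ℕ) : (unaryEncodeNat n).drop k = unaryEncodeNat (n - k) := by
  induction n generalizing k with
  | zero => simp [unaryEncodeNat]
  | succ n ih =>
    cases k with
    | zero => rfl
    | succ k => simpa [unaryEncodeNat] using ih k

theorem map_refl_unaryEncodeNat (l : List Bool) : l.map (Equiv.refl Bool).invFun = l := by
  simp

/-- The approximation of `2⁻ᵏ` from below by `(2 ^ (n - k) - 1) / 2 ^ n` is computed by removing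
`k` ones from the list of ones that encodes `n`. -/
theorem isPolyTimeComputableReal_inv_two_pow (k : ℕ) :
    IsPolyTimeComputableReal ((2 ^ k)⁻¹ : ℝ) := by
  refine ⟨fun n => 2 ^ (n - k) - 1, ⟨{
    tm := popMachine k
    inputAlphabet := Equiv.refl Bool
    outputAlphabet := Equiv.refl Bool
    time := 1
    outputsFun := fun n => { steps := 1, evals_in_steps := ?_, steps_le_m := by simp } }⟩, ?_⟩
  · have h := stepAux_popStmt k (unaryEncodeNat n)
    rw [encodeNat_two_pow_sub_one, ← drop_unaryEncodeNat]
    erw [map_refl_unaryEncodeNat, map_refl_unaryEncodeNat]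
    exact congrArg some h
  · intro n
    have h2 : (0 : ℝ) < 2 ^ n := by positivity
    rw [abs_of_pos (by positivity : (0 : ℝ) < (2 ^ k)⁻¹), Nat.cast_sub Nat.one_le_two_pow]
    push_cast
    rcases le_total k n with h | h
    · have : (2 : ℝ) ^ n = 2 ^ (n - k) * 2 ^ k := by rw [← pow_add, Nat.sub_add_cancel h]
      have e : ((2 : ℝ) ^ (n - k) - 1) / 2 ^ n - (2 ^ k)⁻¹ = -(1 / 2 ^ n) := by
        rw [this]
        field_simp
        ring
      rw [e, abs_neg, abs_of_pos (by positivity)]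
    · rw [Nat.sub_eq_zero_of_le h]
      simp only [pow_zero, sub_self, zero_div, zero_sub, abs_neg]
      rw [abs_of_pos (by positivity), one_div]
      exact inv_anti₀ h2 (pow_le_pow_right₀ (by norm_num) h)

/-- A machine with one stack, which it empties. Its internal state records whether the last pop
found a symbol, so that it is back in its initial state when the stack is empty. -/
def clearMachine : FinTM2 where
  K := Unit
  k₀ := ()
  k₁ := ()
  Γ _ := Bool
  Λ := Unit
  main := ()
  σ := Bool
  initialState := false
  m _ := TM2.Stmt.pop () (fun _ x => x.isSome)
    (TM2.Stmt.branch id (TM2.Stmt.goto fun _ => ()) TM2.Stmt.halt)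

/-- The machine takes one step for each symbol on the stack, and one more to find it empty. -/
theorem iterate_step_clearMachine (l : List Bool) (v : Bool) :
    (flip bind clearMachine.step)^[l.length + 1]
      (some (⟨some (), v, fun _ => l⟩ : TM2.Cfg (fun _ : Unit => Bool) Unit Bool)) =
      some (⟨none, false, fun _ => []⟩ : TM2.Cfg (fun _ : Unit => Bool) Unit Bool) := by
  induction l generalizing v with
  | nil =>
    change some _ = some _
    congr 2
  | cons x l ih =>
    rw [List.length_cons, Function.iterate_succ_apply, ← ih true]
    congr 2

/-- Zero is approximated by zero: its binary encoding is the empty list, so the machine only has to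
remove its input. -/
theorem isPolyTimeComputableReal_zero : IsPolyTimeComputableReal 0 := by
  refine ⟨fun _ => 0, ⟨{
    tm := clearMachine
    inputAlphabet := Equiv.refl Bool
    outputAlphabet := Equiv.refl Bool
    time := Polynomial.X + 1
    outputsFun := fun n => { steps := (unaryEncodeNat n).length + 1,
                             evals_in_steps := ?_, steps_le_m := by simp } }⟩, ?_⟩
  · erw [map_refl_unaryEncodeNat]
    exact iterate_step_clearMachine (unaryEncodeNat n) false
  · intro n
    simp

end

/-! ### Halting probabilities -/

namespace PTM

variable {A H : Type}

/-- The probability that `M`, started in configuration `c` on input `w`, halts with outcome `h`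
within `t` steps. -/
def hit (M : PTM A H) (w : List A) (h : H) (t : ℕ) (c : Config M.Q M.Γ) : ℝ≥0∞ :=
  (M.run w t c).toOuterMeasure {c | M.outcome c.state = some h}

/-- The probability that `M`, started in configuration `c` on input `w`, ever halts with outcome
`h`. -/
def value (M : PTM A H) (w : List A) (h : H) (c : Config M.Q M.Γ) : ℝ≥0∞ :=
  ⨆ t, M.hit w h t c

/-- The distribution of the next move in configuration `c` on input `w`. -/
abbrev moves (M : PTM A H) (w : List A) (c : Config M.Q M.Γ) :
    PMF (M.Q × HeadMove × M.Γ × HeadMove) :=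
  M.δ c.state (inputAt w c.inPos) (c.tape c.workPos)

variable {M : PTM A H} {w : List A} {h h' : H} {t : ℕ} {c : Config M.Q M.Γ}

theorem haltProb_eq_toReal_value (M : PTM A H) (w : List A) (h : H) :
    M.haltProb w h = (M.value w h M.init).toReal := rfl

theorem step_of_continuing (hc : M.outcome c.state = none) :
    M.step w c = (M.moves w c).map (M.applyMove c) := by
  rw [step, hc]

theorem step_of_halting (hc : M.outcome c.state = some h) : M.step w c = PMF.pure c := by
  rw [step, hc]

theorem run_of_halting (hc : M.outcome c.state = some h) (t : ℕ) :
    M.run w t c = PMF.pure c := by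
  induction t with
  | zero => rfl
  | succ t ih => rw [run, step_of_halting hc, PMF.pure_bind, ih]

theorem hit_of_halting (hc : M.outcome c.state = some h) : M.hit w h t c = 1 := by
  rw [hit, run_of_halting hc, PMF.toOuterMeasure_pure_apply]
  exact if_pos hc

theorem hit_of_halting_ne (hc : M.outcome c.state = some h') (hne : h' ≠ h) :
    M.hit w h t c = 0 := by
  rw [hit, run_of_halting hc, PMF.toOuterMeasure_pure_apply, if_neg]
  simpa [hc] using hne

theorem hit_zero_of_continuing (hc : M.outcome c.state = none) : M.hit w h 0 c = 0 := by
  rw [hit, run, PMF.toOuterMeasure_pure_apply, if_neg]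
  simp [hc]

theorem hit_succ_of_continuing (hc : M.outcome c.state = none) :
    M.hit w h (t + 1) c = ∑' x, M.moves w c x * M.hit w h t (M.applyMove c x) := by
  rw [hit, run, step_of_continuing hc, PMF.bind_map, PMF.toOuterMeasure_bind_apply]
  rfl

theorem toOuterMeasure_le_one {α : Type*} (p : PMF α) (s : Set α) : p.toOuterMeasure s ≤ 1 :=
  (p.toOuterMeasure.mono (Set.subset_univ s)).trans
    ((p.toOuterMeasure_apply_eq_one_iff _).2 (Set.subset_univ _)).le

theorem hit_mono (M : PTM A H) (w : List A) (h : H) (c : Config M.Q M.Γ) :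
    Monotone fun t => M.hit w h t c := by
  refine monotone_nat_of_le_succ fun t => ?_
  induction t generalizing c with
  | zero =>
    rcases hc : M.outcome c.state with _ | h'
    · simp [hit_zero_of_continuing hc]
    · simp [hit, run_of_halting hc]
  | succ t ih =>
    rcases hc : M.outcome c.state with _ | h'
    · simp only [hit_succ_of_continuing hc]
      exact ENNReal.tsum_le_tsum fun x => mul_le_mul_right (ih _) _
    · simp [hit, run_of_halting hc]

theorem hit_le_value : M.hit w h t c ≤ M.value w h c := le_iSup (fun t => M.hit w h t c) t

theorem value_of_halting (hc : M.outcome c.state = some h) : M.value w h c = 1 := by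
  simp [value, hit_of_halting hc]

theorem value_of_halting_ne (hc : M.outcome c.state = some h') (hne : h' ≠ h) :
    M.value w h c = 0 := by
  simp [value, hit_of_halting_ne hc hne]

instance : Finite HeadMove :=
  Finite.of_injective (fun d : HeadMove => (HeadMove.rec 0 1 2 d : Fin 3)) fun a b => by
    cases a <;> cases b <;> simp

/-- The halting probability is harmonic. The sum over the moves is finite, so it commutes with the
monotone limit in the number of steps. -/
theorem value_of_continuing (hc : M.outcome c.state = none) :
    M.value w h c = ∑' x, M.moves w c x * M.value w h (M.applyMove c x) := by
  have := M.finQ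
  have := M.finΓ
  have := Fintype.ofFinite (M.Q × HeadMove × M.Γ × HeadMove)
  have hsum := ENNReal.finsetSum_iSup_of_monotone (s := Finset.univ)
    (f := fun x t => M.moves w c x * M.hit w h t (M.applyMove c x))
    fun x s t hst => mul_le_mul_right (M.hit_mono w h _ hst) _
  simp only [value, tsum_fintype, ENNReal.mul_iSup]
  rw [hsum, ← (M.hit_mono w h c).iSup_nat_add 1]
  simp only [hit_succ_of_continuing hc, tsum_fintype]

theorem value_add_value_le_one (M : PTM A H) (w : List A) (hne : h ≠ h') (c : Config M.Q M.Γ) :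
    M.value w h c + M.value w h' c ≤ 1 := by
  rw [value, value, ENNReal.iSup_add_iSup_of_monotone (M.hit_mono w h c) (M.hit_mono w h' c)]
  refine iSup_le fun t => ?_
  refine le_trans (le_of_eq ?_) (toOuterMeasure_le_one (M.run w t c)
    ({c | M.outcome c.state = some h} ∪ {c | M.outcome c.state = some h'}))
  simp only [hit, PMF.toOuterMeasure_apply]
  rw [← ENNReal.tsum_add]
  refine tsum_congr fun x => ?_
  rw [Set.indicator_union_of_disjoint]
  rw [Set.disjoint_left]
  intro a ha ha'
  exact hne (Option.some.inj (ha.symm.trans ha'))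

theorem value_le_one (M : PTM A H) (w : List A) (h : H) (c : Config M.Q M.Γ) :
    M.value w h c ≤ 1 :=
  iSup_le fun _ => toOuterMeasure_le_one _ _

theorem haltProb_add_haltProb_le_one (M : PTM A H) (w : List A) (hne : h ≠ h') :
    M.haltProb w h + M.haltProb w h' ≤ 1 := by
  rw [haltProb_eq_toReal_value, haltProb_eq_toReal_value, ← ENNReal.toReal_add
    (ne_top_of_le_ne_top ENNReal.one_ne_top (M.value_le_one ..))
    (ne_top_of_le_ne_top ENNReal.one_ne_top (M.value_le_one ..))]
  exact ENNReal.toReal_le_of_le_ofReal zero_le_one (by simpa using M.value_add_value_le_one w hne _)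

/-! ### Machines with postselection simulate standard machines -/

/-- The postselection outcome that corresponds to an outcome of a standard machine. -/
def _root_.StdHalt.toPost : StdHalt → PostHalt
  | StdHalt.accept => PostHalt.accept
  | StdHalt.reject => PostHalt.reject

/-- A standard machine, regarded as a machine with postselection that has no nonpostselection
halting states. -/
def toPost (M : PTM A StdHalt) : PTM A PostHalt where
  Q := M.Q
  Γ := M.Γ
  finQ := M.finQ
  finΓ := M.finΓ
  blank := M.blank
  start := M.start
  outcome q := (M.outcome q).map StdHalt.toPost
  δ := M.δ
  computable := M.computable
  cent_not_left := M.cent_not_left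
  dollar_not_right := M.dollar_not_right

theorem toPost_step (M : PTM A StdHalt) (w : List A) (c : Config M.Q M.Γ) :
    M.toPost.step w c = M.step w c := by
  rcases hc : M.outcome c.state with _ | h
  · rw [step_of_continuing hc]
    exact step_of_continuing (M := M.toPost) (by simp [toPost, hc])
  · rw [step_of_halting hc]
    exact step_of_halting (M := M.toPost) (h := h.toPost) (by simp [toPost, hc])

theorem toPost_run (M : PTM A StdHalt) (w : List A) (t : ℕ) (c : Config M.Q M.Γ) :
    M.toPost.run w t c = M.run w t c := by
  induction t generalizing c with
  | zero => rfl
  | succ t ih =>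
    have : M.toPost.run w t = M.run w t := funext ih
    exact congrArg₂ PMF.bind (M.toPost_step w c) this

theorem toPost_haltProb (M : PTM A StdHalt) (w : List A) (h : StdHalt) :
    M.toPost.haltProb w h.toPost = M.haltProb w h := by
  have hs : {c : Config M.Q M.Γ | M.toPost.outcome c.state = some h.toPost} =
      {c | M.outcome c.state = some h} := by
    ext c
    rcases hc : M.outcome c.state with _ | h'
    · simp [toPost, hc]
    · cases h <;> cases h' <;> simp [toPost, hc, StdHalt.toPost]
  unfold haltProb
  congr 2
  funext t
  exact congrArg₂ (fun (p : PMF (Config M.Q M.Γ)) s => p.toOuterMeasure s)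
    (M.toPost_run w t M.init) hs

theorem toPost_usesSpace {M : PTM A StdHalt} {s : ℕ → ℕ} (hM : M.UsesSpace s) :
    M.toPost.UsesSpace s := by
  intro w
  have : M.toPost.visitedCells w = M.visitedCells w := by
    have (t : ℕ) : M.toPost.run w t M.toPost.init = M.run w t M.init := M.toPost_run w t M.init
    unfold visitedCells
    simp_rw [this]
    rfl
  rw [this]
  exact hM w

end PTM

/-- The halting probabilities of a standard machine add up to at most `1`, so conditioning on
halting does not decrease them. Bounded error makes their sum positive. -/
theorem oneWayBPSPACE_subset_postOneWayBPSPACE (A : Type) (s : ℕ → ℕ) :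
    OneWayBPSPACE A s ⊆ PostOneWayBPSPACE A s := by
  rintro L ⟨M, hM, hs, ε, hε0, hε, hacc, hrej⟩
  have ha (w) : M.toPost.haltProb w PostHalt.accept = M.haltProb w StdHalt.accept :=
    M.toPost_haltProb w StdHalt.accept
  have hr (w) : M.toPost.haltProb w PostHalt.reject = M.haltProb w StdHalt.reject :=
    M.toPost_haltProb w StdHalt.reject
  have ha0 (w) : 0 ≤ M.haltProb w StdHalt.accept := ENNReal.toReal_nonneg
  have hr0 (w) : 0 ≤ M.haltProb w StdHalt.reject := ENNReal.toReal_nonneg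
  have hle (w) : M.haltProb w StdHalt.accept + M.haltProb w StdHalt.reject ≤ 1 :=
    M.haltProb_add_haltProb_le_one w (by simp)
  have hpos (w) : 0 < M.haltProb w StdHalt.accept + M.haltProb w StdHalt.reject := by
    by_cases hw : w ∈ L
    · linarith [hacc w hw, hr0 w]
    · linarith [hrej w hw, ha0 w]
  refine ⟨M.toPost, fun w => ?_, hM, PTM.toPost_usesSpace hs, ε, hε0, hε,
    fun w hw => (hacc w hw).trans ?_, fun w hw => (hrej w hw).trans ?_⟩
  · rw [ha, hr]
    exact hpos w
  · rw [PTM.postAcceptProb, ha, hr]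
    exact le_div_self (ha0 w) (hpos w) (hle w)
  · rw [PTM.postRejectProb, ha, hr]
    exact le_div_self (hr0 w) (hpos w) (hle w)

/-! ### Comparing two letter counts with postselection -/

section

/-- The modes of the machine that compares two letter counts: the initial one, three modes that
read the input, and one for each halting outcome. -/
inductive CountMode : Type
  | start
  | track (i : Fin 3)
  | halt (h : PostHalt)

namespace CountMode

variable {A : Type}

instance : Finite PostHalt :=
  Finite.of_injective (fun h : PostHalt => (PostHalt.rec 0 1 2 h : Fin 3)) fun a b => by
    cases a <;> cases b <;> simp

instance : Finite CountMode :=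
  Finite.of_surjective
    (fun z : (Unit ⊕ Fin 3) ⊕ PostHalt => match z with
      | .inl (.inl _) => start
      | .inl (.inr i) => track i
      | .inr h => halt h)
    fun m => by
      cases m with
      | start => exact ⟨.inl (.inl ()), rfl⟩
      | track i => exact ⟨.inl (.inr i), rfl⟩
      | halt h => exact ⟨.inr h, rfl⟩

/-- The outcome of a mode, if it is a halting one. -/
def outcome : CountMode → Option PostHalt
  | halt h => some h
  | _ => none

/-- The letters that endanger the tracking mode `i`: both `a` and `b` for `i = 0`, only `a` for
`i = 1`, and only `b` for `i = 2`. -/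
def risky (a b : A) : Fin 3 → A → Prop
  | 0, x => x = a ∨ x = b
  | 1, x => x = a
  | 2, x => x = b

/-- The number of sides of the die with which the tracking mode `i` survives a risky letter. -/
def lucky : Fin 3 → ℕ
  | 0 => 8
  | 1 => 1
  | 2 => 1

/-- The outcome of the tracking mode `i` when it survives the whole input. -/
def final : Fin 3 → PostHalt
  | 0 => .accept
  | 1 => .reject
  | 2 => .reject

open Classical in
/-- The mode that follows when a die with `64` sides shows `r`. -/
def next (a b : A) : CountMode → InputSym A → Fin 64 → CountMode
  | start, _, r => if r.val < 40 then track 0 else if r.val < 52 then track 1 else track 2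
  | track i, .letter x, r => if risky a b i x ∧ ¬ r.val < lucky i then halt .nonpost else track i
  | track i, .dollar, _ => halt (final i)
  | m, _, _ => m

/-- The input head moves right until it reaches the right end-marker. -/
def dir : InputSym A → HeadMove
  | .dollar => .stationary
  | _ => .right

theorem dir_ne_left (σ : InputSym A) : dir σ ≠ HeadMove.left := by
  cases σ <;> simp [dir]

/-- The move made by the machine when the die shows `r`. The new state records `r`, so that
distinct results of the die are distinct moves. -/
def move (a b : A) (m : CountMode) (σ : InputSym A) (r : Fin 64) :
    (CountMode × Fin 64) × HeadMove × Unit × HeadMove :=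
  ((next a b m σ r, r), dir σ, (), .stationary)

end CountMode

open CountMode

/-- The image of the uniform distribution on the sides of a die under an injective map takes only
the values `1 / 64` and `0`. -/
theorem isPolyTimeComputableReal_map_uniform {β : Type*} {f : Fin 64 → β}
    (hf : Function.Injective f) (x : β) :
    IsPolyTimeComputableReal (((PMF.uniformOfFintype (Fin 64)).map f) x).toReal := by
  classical
  rw [PMF.map_apply]
  by_cases hx : ∃ r, x = f r
  · obtain ⟨r, rfl⟩ := hx
    rw [tsum_eq_single r fun r' hr' => if_neg fun h => hr' (hf h).symm, if_pos rfl]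
    convert isPolyTimeComputableReal_inv_two_pow 6 using 1
    simp
    norm_num
  · push Not at hx
    simpa [hx] using isPolyTimeComputableReal_zero

/-- A finite automaton with postselection that compares the numbers of occurrences of the letters
`a` and `b` in its input: a machine with a single work tape symbol, whose work head never moves. The
last result of the die is part of the state, so that every transition probability is `0` or
`1 / 64`. -/
def countMachine {A : Type} (a b : A) : PTM A PostHalt where
  Q := CountMode × Fin 64
  Γ := Unit
  blank := ()
  start := (.start, 0)
  outcome q := q.1.outcome
  δ q σ _ := (PMF.uniformOfFintype (Fin 64)).map (CountMode.move a b q.1 σ)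
  computable _ _ _ := isPolyTimeComputableReal_map_uniform fun r r' h => by
    simpa [CountMode.move] using (congrArg (fun x => x.1.2) h : r = r')
  cent_not_left q γ q' γ' d := by
    simp [PMF.map_apply, CountMode.move, dir]
  dollar_not_right q γ q' γ' d := by
    simp [PMF.map_apply, CountMode.move, dir]

theorem PMF.tsum_map_mul {α β : Type*} (p : PMF α) (f : α → β) (g : β → ℝ≥0∞) :
    ∑' y, (p.map f) y * g y = ∑' x, p x * g (f x) := by
  classical
  simp only [PMF.map_apply, ← ENNReal.tsum_mul_right]
  rw [ENNReal.tsum_comm]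
  refine tsum_congr fun x => ?_
  rw [tsum_eq_single (f x) fun y hy => by simp [hy]]
  simp

section

variable {A : Type} {a b : A} {w : List A} {h : PostHalt}

/-- The configurations of the machine that compares two letter counts. -/
abbrev CountConfig : Type := PTM.Config (CountMode × Fin 64) Unit

/-- The configuration that follows `c` when the die shows `r`. -/
def countNext (a b : A) (w : List A) (c : CountConfig) (r : Fin 64) : CountConfig :=
  (countMachine a b).applyMove c (CountMode.move a b c.state.1 (PTM.inputAt w c.inPos) r)

theorem countNext_state (c : CountConfig) (r : Fin 64) :
    (countNext a b w c r).state.1 = next a b c.state.1 (PTM.inputAt w c.inPos) r := rfl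

theorem countNext_inPos (c : CountConfig) (r : Fin 64) (hc : PTM.inputAt w c.inPos ≠ .dollar) :
    (countNext a b w c r).inPos = c.inPos + 1 := by
  change PTM.moveIn (dir (PTM.inputAt w c.inPos)) c.inPos = _
  generalize PTM.inputAt w c.inPos = σ at hc
  cases σ <;> simp_all [dir, PTM.moveIn]

theorem value_countMachine {c : CountConfig} (hc : c.state.1.outcome = none) :
    (countMachine a b).value w h c =
      ∑ r, 64⁻¹ * (countMachine a b).value w h (countNext a b w c r) := by
  rw [PTM.value_of_continuing (M := countMachine a b) hc]
  refine (PMF.tsum_map_mul _ _ _).trans ?_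
  simp only [PMF.uniformOfFintype_apply, Fintype.card_fin, tsum_fintype]
  rfl

/-- If the value after the next move is `V` for `k` of the `64` sides of the die and `0` for the
others, then the value is `k / 64 * V`. -/
theorem value_countMachine_of_forall {c : CountConfig} (hc : c.state.1.outcome = none) (V : ℝ≥0∞)
    (P : Fin 64 → Prop) [DecidablePred P] (hP : ∀ r, P r →
      (countMachine a b).value w h (countNext a b w c r) = V)
    (hP' : ∀ r, ¬ P r → (countMachine a b).value w h (countNext a b w c r) = 0) :
    (countMachine a b).value w h c = ((Finset.univ.filter P).card * 64⁻¹) * V := by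
  have hsum (r : Fin 64) : 64⁻¹ * (countMachine a b).value w h (countNext a b w c r) =
      if P r then 64⁻¹ * V else 0 := by
    split_ifs with hr
    · rw [hP r hr]
    · rw [hP' r hr, mul_zero]
  rw [value_countMachine hc, Finset.sum_congr rfl fun r _ => hsum r, ← Finset.sum_filter,
    Finset.sum_const, nsmul_eq_mul, mul_assoc]

theorem value_countMachine_const {c : CountConfig} (hc : c.state.1.outcome = none) (V : ℝ≥0∞)
    (hV : ∀ r, (countMachine a b).value w h (countNext a b w c r) = V) :
    (countMachine a b).value w h c = V := by
  rw [value_countMachine_of_forall hc V (fun _ => True) (fun r _ => hV r) (by simp)]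
  rw [Finset.filter_true, Finset.card_univ, Fintype.card_fin, Nat.cast_ofNat,
    ENNReal.mul_inv_cancel (by simp) (by simp), one_mul]

theorem outcome_halt (h : PostHalt) : (CountMode.halt h).outcome = some h := rfl

theorem inputAt_append_cons (u v : List A) (x : A) :
    PTM.inputAt (u ++ x :: v) (u.length + 1) = .letter x := by
  simp [PTM.inputAt]

theorem inputAt_length_add_one (u : List A) : PTM.inputAt u (u.length + 1) = .dollar := by
  simp [PTM.inputAt]

theorem value_countMachine_halt {c : CountConfig} (hc : c.state.1 = .halt h) :
    (countMachine a b).value w h c = 1 :=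
  PTM.value_of_halting (M := countMachine a b) (by rw [← outcome_halt h, ← hc]; rfl)

theorem value_countMachine_halt_ne {c : CountConfig} {h' : PostHalt} (hc : c.state.1 = .halt h')
    (hne : h' ≠ h) : (countMachine a b).value w h c = 0 :=
  PTM.value_of_halting_ne (M := countMachine a b) (by rw [← outcome_halt h', ← hc]; rfl) hne

open Classical in
/-- A tracking mode at the beginning of the suffix `v` of the input ends with its outcome if it
survives every risky letter of `v`, and otherwise halts without postselection. -/
theorem value_countMachine_track (i : Fin 3) (hh : h ≠ .nonpost) (u v : List A) (c : CountConfig)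
    (hc : c.state.1 = .track i) (hi : c.inPos = u.length + 1) :
    (countMachine a b).value (u ++ v) h c =
      if final i = h then ((lucky i : ℝ≥0∞) * 64⁻¹) ^ v.countP (fun x => risky a b i x) else 0 := by
  have hc' : c.state.1.outcome = none := by rw [hc]; rfl
  induction v generalizing u c with
  | nil =>
    have hin : PTM.inputAt (u ++ []) c.inPos = .dollar := by
      rw [hi, List.append_nil, inputAt_length_add_one]
    have hst (r) : (countNext a b (u ++ []) c r).state.1 = .halt (final i) := by
      rw [countNext_state, hin, hc]
      rfl
    refine value_countMachine_const hc' _ fun r => ?_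
    split_ifs with hf
    · rw [List.countP_nil, pow_zero]
      exact value_countMachine_halt (hf ▸ hst r)
    · exact value_countMachine_halt_ne (hst r) hf
  | cons x v ih =>
    have hin : PTM.inputAt (u ++ x :: v) c.inPos = .letter x := by
      rw [hi, inputAt_append_cons]
    have hsurv (r) (hr : ¬ (risky a b i x ∧ ¬ r.val < lucky i)) :
        (countMachine a b).value (u ++ x :: v) h (countNext a b (u ++ x :: v) c r) =
          if final i = h then ((lucky i : ℝ≥0∞) * 64⁻¹) ^ v.countP (fun x => risky a b i x)
          else 0 := by
      have e : u ++ x :: v = (u ++ [x]) ++ v := by simp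
      have hst : (countNext a b (u ++ x :: v) c r).state.1 = .track i := by
        rw [countNext_state, hin, hc, next, if_neg hr]
      have hpos : (countNext a b (u ++ x :: v) c r).inPos = (u ++ [x]).length + 1 := by
        rw [countNext_inPos _ _ (by rw [hin]; simp), hi]
        simp
      have := ih (u ++ [x]) _ hst hpos (by rw [hst]; rfl)
      rwa [← e] at this
    by_cases hx : risky a b i x
    · have hdie (r) (hr : ¬ r.val < lucky i) :
          (countMachine a b).value (u ++ x :: v) h (countNext a b (u ++ x :: v) c r) = 0 :=
        value_countMachine_halt_ne (h' := .nonpost)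
          (by rw [countNext_state, hin, hc, next, if_pos ⟨hx, hr⟩]) hh.symm
      have hcard : (Finset.univ.filter fun r : Fin 64 => r.val < lucky i).card = lucky i := by
        fin_cases i <;> decide
      rw [value_countMachine_of_forall hc' _ (fun r => r.val < lucky i)
        (fun r hr => hsurv r (by simp [hr])) hdie, hcard,
        List.countP_cons_of_pos (by simpa using hx)]
      split_ifs
      · rw [pow_succ']
      · simp
    · rw [value_countMachine_const hc' _ fun r => hsurv r (by simp [hx]),
        List.countP_cons_of_neg (by simpa using hx)]

open Classical in
theorem value_countNext_init (hh : h ≠ .nonpost) {i : Fin 3} {r : Fin 64}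
    (hr : next a b .start .cent r = .track i) :
    (countMachine a b).value w h (countNext a b w (countMachine a b).init r) =
      if final i = h then ((lucky i : ℝ≥0∞) * 64⁻¹) ^ w.countP (fun x => risky a b i x) else 0 :=
  value_countMachine_track i hh [] w (countNext a b w (countMachine a b).init r) hr rfl

open Classical in
/-- The mode `track 0` is chosen with probability `40 / 64`, and only this mode can accept. -/
theorem value_accept_countMachine (a b : A) (w : List A) :
    (countMachine a b).value w .accept (countMachine a b).init =
      40 * 64⁻¹ * (8 * 64⁻¹) ^ w.countP (fun x => risky a b 0 x) := by
  have hcard : (Finset.univ.filter fun r : Fin 64 => r.val < 40).card = 40 := by decide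
  refine (value_countMachine_of_forall (c := (countMachine a b).init) rfl _ (fun r => r.val < 40)
    (fun r hr => value_countNext_init (by simp) (if_pos hr)) fun r hr => ?_).trans
    (by rw [hcard]; simp [final, lucky])
  by_cases hr' : r.val < 52
  · exact (value_countNext_init (i := 1) (by simp)
      (show next a b .start .cent r = _ by simp [next, hr, hr'])).trans (if_neg (by simp [final]))
  · exact (value_countNext_init (i := 2) (by simp)
      (show next a b .start .cent r = _ by simp [next, hr, hr'])).trans (if_neg (by simp [final]))

open Classical in
/-- The modes `track 1` and `track 2` are chosen with probability `12 / 64` each. -/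
theorem value_reject_countMachine (a b : A) (w : List A) :
    (countMachine a b).value w .reject (countMachine a b).init =
      12 * 64⁻¹ * (64⁻¹ ^ w.countP (fun x => risky a b 1 x) +
        64⁻¹ ^ w.countP (fun x => risky a b 2 x)) := by
  have hsum (r : Fin 64) : 64⁻¹ * (countMachine a b).value w .reject
      (countNext a b w (countMachine a b).init r) =
      (if 40 ≤ r.val ∧ r.val < 52 then
        64⁻¹ * 64⁻¹ ^ w.countP (fun x => risky a b 1 x) else 0) +
      (if 52 ≤ r.val then 64⁻¹ * 64⁻¹ ^ w.countP (fun x => risky a b 2 x) else 0) := by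
    by_cases hr : r.val < 40
    · have hv := value_countNext_init (a := a) (b := b) (w := w) (h := .reject) (i := 0) (by simp)
        (if_pos hr)
      rw [if_neg (by simp [final])] at hv
      rw [hv, if_neg (by omega), if_neg (by omega)]
      simp
    · by_cases hr' : r.val < 52
      · have hv := value_countNext_init (w := w) (h := .reject) (i := 1) (by simp)
          (show next a b .start .cent r = _ by simp [next, hr, hr'])
        rw [if_pos (show final 1 = .reject from rfl)] at hv
        rw [hv, if_pos (by omega), if_neg (by omega)]
        simp [lucky]
      · have hv := value_countNext_init (w := w) (h := .reject) (i := 2) (by simp)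
          (show next a b .start .cent r = _ by simp [next, hr, hr'])
        rw [if_pos (show final 2 = .reject from rfl)] at hv
        rw [hv, if_neg (by omega), if_pos (by omega)]
        simp [lucky]
  have hcard1 : (Finset.univ.filter fun r : Fin 64 => 40 ≤ r.val ∧ r.val < 52).card = 12 := by
    decide
  have hcard2 : (Finset.univ.filter fun r : Fin 64 => 52 ≤ r.val).card = 12 := by
    decide
  refine (value_countMachine (c := (countMachine a b).init) rfl).trans ?_
  rw [Finset.sum_congr rfl fun r _ => hsum r, Finset.sum_add_distrib,
    ← Finset.sum_filter, ← Finset.sum_filter, Finset.sum_const, Finset.sum_const, hcard1, hcard2]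
  simp only [nsmul_eq_mul, Nat.cast_ofNat]
  ring

open Classical in
theorem countP_risky_zero (hab : a ≠ b) (w : List A) :
    w.countP (fun x => risky a b 0 x) = w.count a + w.count b := by
  induction w with
  | nil => rfl
  | cons x w ih =>
    rw [List.countP_cons, List.count_cons, List.count_cons, ih]
    by_cases ha : x = a
    · subst ha
      simp [risky, hab]
      ring
    · by_cases hb : x = b
      · subst hb
        simp [risky, hab.symm]
        ring
      · simp [risky, ha, hb]

open Classical in
theorem countP_risky_one (w : List A) : w.countP (fun x => risky a b 1 x) = w.count a := by
  rw [List.count]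
  congr 1

open Classical in
theorem countP_risky_two (w : List A) : w.countP (fun x => risky a b 2 x) = w.count b := by
  rw [List.count]
  congr 1

open Classical in
theorem haltProb_accept_countMachine (hab : a ≠ b) (w : List A) :
    (countMachine a b).haltProb w .accept = 5 / 8 * ((8⁻¹) ^ w.count a * (8⁻¹) ^ w.count b) := by
  rw [PTM.haltProb_eq_toReal_value, value_accept_countMachine, countP_risky_zero hab]
  simp only [ENNReal.toReal_mul, ENNReal.toReal_pow, ENNReal.toReal_inv, ENNReal.toReal_ofNat,
    pow_add]
  norm_num

open Classical in
theorem haltProb_reject_countMachine (a b : A) (w : List A) :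
    (countMachine a b).haltProb w .reject =
      3 / 16 * (((8⁻¹) ^ w.count a) ^ 2 + ((8⁻¹) ^ w.count b) ^ 2) := by
  have h64 (k : ℕ) : (64⁻¹ : ℝ≥0∞) ^ k ≠ ⊤ := by simp
  rw [PTM.haltProb_eq_toReal_value, value_reject_countMachine, countP_risky_one, countP_risky_two,
    ENNReal.toReal_mul, ENNReal.toReal_add (h64 _) (h64 _)]
  simp only [ENNReal.toReal_mul, ENNReal.toReal_pow, ENNReal.toReal_inv, ENNReal.toReal_ofNat]
  rw [← pow_mul, ← pow_mul, mul_comm _ 2, mul_comm _ 2, pow_mul, pow_mul]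
  norm_num

theorem isOneWay_countMachine (a b : A) : (countMachine a b).IsOneWay := by
  intro q σ γ q' γ' d
  refine (PMF.apply_eq_zero_iff _ _).2 fun hx => ?_
  obtain ⟨r, -, hr⟩ := (PMF.mem_support_map_iff _ _ _).1 hx
  exact dir_ne_left σ (congrArg (fun x => x.2.1) hr)

/-- The work head of the machine never moves. -/
theorem workPos_of_mem_support_run (t : ℕ) (c c' : CountConfig)
    (hc : c' ∈ ((countMachine a b).run w t c).support) : c'.workPos = c.workPos := by
  induction t generalizing c with
  | zero =>
    rw [(PMF.mem_support_pure_iff _ _).1 hc]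
  | succ t ih =>
    obtain ⟨d, hd, hd'⟩ := (PMF.mem_support_bind_iff _ _ _).1 hc
    rw [ih d hd']
    rcases hs : (countMachine a b).outcome c.state with _ | h
    · rw [PTM.step_of_continuing hs, PMF.mem_support_map_iff] at hd
      obtain ⟨x, hx, rfl⟩ := hd
      obtain ⟨r, -, rfl⟩ := (PMF.mem_support_map_iff _ _ _).1 hx
      rfl
    · rw [PTM.step_of_halting hs] at hd
      rw [(PMF.mem_support_pure_iff _ _).1 hd]

theorem usesSpace_countMachine (a b : A) {s : ℕ → ℕ} (hs : ∀ n, 1 ≤ s n) :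
    (countMachine a b).UsesSpace s := by
  intro w
  have hsub : (countMachine a b).visitedCells w ⊆ {0} := by
    rintro z ⟨t, c, hc, rfl⟩
    exact workPos_of_mem_support_run t _ _ hc
  refine (Set.encard_le_encard hsub).trans ?_
  rw [Set.encard_singleton]
  exact_mod_cast hs w.length

/-- If `y` is at most an eighth of `x`, then the joint weight is small. -/
theorem five_eighths_le_div {x y : ℝ} (hy : 0 < y) (hxy : 8 * y ≤ x) :
    1 - 3 / 8 ≤ 3 / 16 * (x ^ 2 + y ^ 2) / (5 / 8 * (x * y) + 3 / 16 * (x ^ 2 + y ^ 2)) := by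
  have hx : 0 < x := by linarith
  rw [le_div_iff₀ (by positivity)]
  nlinarith [mul_le_mul_of_nonneg_left hxy hx.le, mul_pos hx hy, sq_nonneg y]

open Classical in
/-- The words in which two given letters occur equally often. -/
def equalCounts (a b : A) : Language A :=
  {w | w.count a = w.count b}

/-- With `x = 8⁻ᵐ` and `y = 8⁻ⁿ` for the letter counts `m` and `n`, the machine accepts with weight
`5 / 8 * (x * y)` and rejects with weight `3 / 16 * (x ^ 2 + y ^ 2)`, which is much larger than the
former unless `m = n`. -/
theorem equalCounts_mem_postOneWayBPSPACE (hab : a ≠ b) {s : ℕ → ℕ} (hs : ∀ n, 1 ≤ s n) :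
    equalCounts a b ∈ PostOneWayBPSPACE A s := by
  classical
  refine ⟨countMachine a b, fun w => ?_, isOneWay_countMachine a b, usesSpace_countMachine a b hs,
    3 / 8, by norm_num, by norm_num, fun w hw => ?_, fun w hw => ?_⟩
  · rw [haltProb_accept_countMachine hab, haltProb_reject_countMachine]
    positivity
  · replace hw : w.count a = w.count b := hw
    rw [PTM.postAcceptProb, haltProb_accept_countMachine hab, haltProb_reject_countMachine, hw]
    have : (0 : ℝ) < 8⁻¹ ^ w.count b := by positivity
    rw [le_div_iff₀ (by positivity)]
    nlinarith
  · replace hw : w.count a ≠ w.count b := hw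
    rw [PTM.postRejectProb, haltProb_accept_countMachine hab, haltProb_reject_countMachine]
    have hpow {m n : ℕ} (hmn : m < n) : 8 * (8⁻¹ : ℝ) ^ n ≤ 8⁻¹ ^ m := by
      have : (8⁻¹ : ℝ) ^ n ≤ 8⁻¹ ^ (m + 1) :=
        pow_le_pow_of_le_one (by norm_num) (by norm_num) hmn
      rw [pow_succ] at this
      linarith
    rcases lt_or_gt_of_ne hw with h | h
    · exact five_eighths_le_div (by positivity) (hpow h)
    · rw [mul_comm (8⁻¹ ^ w.count a), add_comm ((8⁻¹ ^ w.count a) ^ 2)]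
      exact five_eighths_le_div (by positivity) (hpow h)

end

end

/-! ### Work configurations of one-way machines -/

namespace PTM

variable {A H : Type} {M : PTM A H} {w : List A} {h : H} {c : PTM.Config M.Q M.Γ}

/-- The configuration `c` occurs with nonzero probability on input `w`. -/
def Reaches (M : PTM A H) (w : List A) (c : Config M.Q M.Γ) : Prop :=
  ∃ t, c ∈ (M.run w t M.init).support

theorem run_succ_eq_bind_step (M : PTM A H) (w : List A) (t : ℕ) (c : Config M.Q M.Γ) :
    M.run w (t + 1) c = (M.run w t c).bind (M.step w) := by
  induction t generalizing c with
  | zero =>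
    rw [run, run, PMF.pure_bind]
    exact PMF.bind_pure _
  | succ t ih =>
    rw [run, run, PMF.bind_bind]
    exact congrArg _ (funext ih)

theorem reaches_init (M : PTM A H) (w : List A) : M.Reaches w M.init :=
  ⟨0, (PMF.mem_support_pure_iff _ _).2 rfl⟩

theorem Reaches.applyMove (hc : M.Reaches w c) (hn : M.outcome c.state = none)
    {z : M.Q × HeadMove × M.Γ × HeadMove} (hz : M.moves w c z ≠ 0) :
    M.Reaches w (M.applyMove c z) := by
  obtain ⟨t, ht⟩ := hc
  refine ⟨t + 1, ?_⟩
  rw [run_succ_eq_bind_step, PMF.mem_support_bind_iff]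
  refine ⟨c, ht, ?_⟩
  rw [step_of_continuing hn, PMF.mem_support_map_iff]
  exact ⟨z, hz, rfl⟩

/-- A property of configurations that holds initially and is preserved by every move that leads to a
reachable configuration holds for all reachable configurations. -/
theorem Reaches.induction {P : Config M.Q M.Γ → Prop} (hinit : P M.init)
    (hstep : ∀ c z, M.Reaches w (M.applyMove c z) → P c → P (M.applyMove c z))
    (hc : M.Reaches w c) : P c := by
  obtain ⟨t, ht⟩ := hc
  induction t generalizing c with
  | zero => rwa [(PMF.mem_support_pure_iff _ _).1 ht]
  | succ t ih =>
    have hc : M.Reaches w c := ⟨t + 1, ht⟩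
    rw [run_succ_eq_bind_step, PMF.mem_support_bind_iff] at ht
    obtain ⟨d, hd, hcd⟩ := ht
    rcases hs : M.outcome d.state with _ | h
    · rw [step_of_continuing hs, PMF.mem_support_map_iff] at hcd
      obtain ⟨z, -, rfl⟩ := hcd
      exact hstep d z hc (ih hd)
    · rw [step_of_halting hs, PMF.mem_support_pure_iff] at hcd
      rw [hcd]
      exact ih hd

theorem Reaches.workPos_mem (hc : M.Reaches w c) : c.workPos ∈ M.visitedCells w := by
  obtain ⟨t, ht⟩ := hc
  exact ⟨t, c, ht, rfl⟩

/-- The work head visits every cell between its initial and its current position. -/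
theorem Reaches.uIcc_subset (hc : M.Reaches w c) : Set.uIcc 0 c.workPos ⊆ M.visitedCells w := by
  refine Reaches.induction (P := fun c => Set.uIcc 0 c.workPos ⊆ M.visitedCells w) ?_
    (fun c z hc ih => ?_) hc
  · rintro z hz
    rw [show z = 0 by simpa [init] using hz]
    exact (M.reaches_init w).workPos_mem
  · intro y hy
    have h1 : (M.applyMove c z).workPos = moveWork z.2.2.2 c.workPos := rfl
    by_cases hyz : y = (M.applyMove c z).workPos
    · exact hyz ▸ hc.workPos_mem
    · apply ih
      rw [h1] at hy hyz
      revert hy hyz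
      cases z.2.2.2 <;> simp only [moveWork, Set.mem_uIcc] <;> omega

/-- Every cell that is not blank has been visited. -/
theorem Reaches.mem_visitedCells_of_tape_ne (hc : M.Reaches w c) {y : ℤ}
    (hy : c.tape y ≠ M.blank) : y ∈ M.visitedCells w := by
  suffices h : (c.tape y ≠ M.blank → y ∈ M.visitedCells w) ∧ c.workPos ∈ M.visitedCells w from
    h.1 hy
  refine Reaches.induction
    (P := fun c => (c.tape y ≠ M.blank → y ∈ M.visitedCells w) ∧ c.workPos ∈ M.visitedCells w)
    ⟨fun h => absurd rfl h, (M.reaches_init w).workPos_mem⟩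
    (fun c z hc ih => ⟨fun hy => ?_, hc.workPos_mem⟩) hc
  by_cases hyc : y = c.workPos
  · exact hyc ▸ ih.2
  · apply ih.1
    have : (M.applyMove c z).tape y = c.tape y := Function.update_of_ne hyc _ _
    rwa [this] at hy

theorem natAbs_le_of_mem_visitedCells {s : ℕ → ℕ} (hs : M.UsesSpace s) {y : ℤ}
    (hy : y ∈ M.visitedCells w) : y.natAbs ≤ s w.length := by
  obtain ⟨t, c, hc, rfl⟩ := hy
  have h1 := (Set.encard_le_encard (Reaches.uIcc_subset ⟨t, hc⟩)).trans (hs w)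
  rw [← Finset.coe_uIcc, Set.encard_coe_eq_coe_finsetCard, Int.card_uIcc] at h1
  have h2 : (c.workPos - 0).natAbs + 1 ≤ s w.length := by exact_mod_cast h1
  rw [sub_zero] at h2
  omega

/-- A configuration without the position of the input head, in which the work head and all
nonblank cells are at distance at most `n` from the initial cell. -/
abbrev WorkConfig (M : PTM A H) (n : ℕ) : Type :=
  M.Q × Finset.Icc (-n : ℤ) n × (Finset.Icc (-n : ℤ) n → M.Γ)

open Classical in
/-- The configuration with input head position `i` that a work configuration stands for. -/
def WorkConfig.toConfig {n : ℕ} (i : ℕ) (κ : M.WorkConfig n) : Config M.Q M.Γ where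
  state := κ.1
  inPos := i
  workPos := κ.2.1
  tape y := if hy : y ∈ Finset.Icc (-n : ℤ) n then κ.2.2 ⟨y, hy⟩ else M.blank

/-- In space `s`, the visited cells form an interval around the initial cell with at most `s` cells,
so every reachable configuration comes from a work configuration. -/
theorem Reaches.exists_toConfig_eq {s : ℕ → ℕ} (hs : M.UsesSpace s) (hc : M.Reaches w c) :
    ∃ κ : M.WorkConfig (s w.length), κ.toConfig c.inPos = c := by
  have hmem {y : ℤ} (hy : y ∈ M.visitedCells w) :
      y ∈ Finset.Icc (-(s w.length) : ℤ) (s w.length) := by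
    have := natAbs_le_of_mem_visitedCells hs hy
    rw [Finset.mem_Icc]
    omega
  refine ⟨(c.state, ⟨c.workPos, hmem hc.workPos_mem⟩, fun y => c.tape y), ?_⟩
  obtain ⟨q, i, p, tape⟩ := c
  simp only [WorkConfig.toConfig, Config.mk.injEq, true_and]
  funext y
  split_ifs with hy
  · rfl
  · by_contra hne
    exact hy (hmem (hc.mem_visitedCells_of_tape_ne (Ne.symm hne)))

theorem inputAt_append_left {x : List A} (y y' : List A) {i : ℕ} (hi : i ≤ x.length) :
    inputAt (x ++ y) i = inputAt (x ++ y') i := by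
  cases i with
  | zero => rfl
  | succ i => simp [inputAt, List.getElem?_append_left (show i < x.length from hi)]

theorem inputAt_append_right {x x' : List A} (y : List A) (hx : x.length = x'.length) {i : ℕ}
    (hi : x.length + 1 ≤ i) : inputAt (x ++ y) i = inputAt (x' ++ y) i := by
  cases i with
  | zero => omega
  | succ i =>
    simp only [inputAt]
    rw [List.getElem?_append_right (by omega), List.getElem?_append_right (by omega), hx]

theorem IsOneWay.inPos_le (hM : M.IsOneWay) {z : M.Q × HeadMove × M.Γ × HeadMove}
    (hz : M.moves w c z ≠ 0) : c.inPos ≤ (M.applyMove c z).inPos := by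
  obtain ⟨q, d, γ, e⟩ := z
  change c.inPos ≤ moveIn d c.inPos
  cases d with
  | left => exact absurd (hM _ _ _ _ _ _) hz
  | right => exact Nat.le_succ _
  | stationary => exact le_rfl

theorem applyMove_inPos_le (c : Config M.Q M.Γ) (z : M.Q × HeadMove × M.Γ × HeadMove) :
    (M.applyMove c z).inPos ≤ c.inPos + 1 := by
  obtain ⟨q, d, γ, e⟩ := z
  change moveIn d c.inPos ≤ _
  cases d <;> simp only [moveIn] <;> omega

/-- A one-way machine that has moved past a prefix of the input has forgotten that prefix. -/
theorem IsOneWay.value_append_congr (hM : M.IsOneWay) {x x' : List A} (y : List A)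
    (hx : x.length = x'.length) (hc : x.length + 1 ≤ c.inPos) :
    M.value (x ++ y) h c = M.value (x' ++ y) h c := by
  refine iSup_congr fun t => ?_
  induction t generalizing c with
  | zero => rfl
  | succ t ih =>
    rcases hs : M.outcome c.state with _ | h'
    · rw [hit_succ_of_continuing hs, hit_succ_of_continuing hs]
      refine tsum_congr fun z => ?_
      have hm : M.moves (x ++ y) c = M.moves (x' ++ y) c := by
        rw [moves, moves, inputAt_append_right y hx hc]
      by_cases hz : M.moves (x ++ y) c z = 0
      · rw [← hm, hz, zero_mul, zero_mul]
      · rw [← hm, ih (hc.trans (hM.inPos_le hz))]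
    · simp only [hit, run_of_halting hs]

/-- The effect of a prefix `x` of the input on the outcome, apart from an error that vanishes for
large `t`, is a vector: the probability `p` of halting with outcome `h` inside `x`, and the
probabilities `v κ` of leaving `x`, within `t` steps, with work configuration `κ`. The outcome on
`x ++ y` is obtained by pairing this vector with a vector that depends only on `y`. -/
theorem exists_profile {I : Type*} [Fintype I] (x y₀ : List A)
    (dec : I → Config M.Q M.Γ)
    (hdec : ∀ c, M.Reaches (x ++ y₀) c → c.inPos = x.length + 1 → ∃ κ, dec κ = c) (t : ℕ)
    (hc : M.Reaches (x ++ y₀) c) (hi : c.inPos ≤ x.length + 1) :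
    ∃ (p : ℝ≥0∞) (v : I → ℝ≥0∞), p ≤ 1 ∧ (∀ κ, v κ ≤ 1) ∧ ∀ y,
      M.hit (x ++ y) h t c ≤ p + ∑ κ, v κ * M.value (x ++ y) h (dec κ) ∧
      p + ∑ κ, v κ * M.value (x ++ y) h (dec κ) ≤ M.value (x ++ y) h c := by
  classical
  induction t using Nat.strong_induction_on generalizing c with | _ t ih
  -- The vector is a unit vector where the head has just left `x`, `p` is `0` or `1` at a halting
  -- configuration, and otherwise both are averages over the next move.
  rcases hi.eq_or_lt with hi | hi
  · obtain ⟨κ, hκ⟩ := hdec c hc hi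
    refine ⟨0, Pi.single κ 1, zero_le_one, fun κ' => ?_, fun y => ?_⟩
    · rw [Pi.single_apply]
      split_ifs <;> simp
    · simp only [Pi.single_apply, ite_mul, one_mul, zero_mul, Finset.sum_ite_eq',
        Finset.mem_univ, if_true, zero_add, hκ]
      exact ⟨hit_le_value, le_rfl⟩
  rcases hs : M.outcome c.state with _ | h'
  swap
  · by_cases hh : h' = h
    · subst hh
      exact ⟨1, 0, by simp, by simp, fun y => by simp [hit_of_halting hs, value_of_halting hs]⟩
    · exact ⟨0, 0, by simp, by simp, fun y => by simp [hit_of_halting_ne hs hh]⟩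
  cases t with
  | zero => exact ⟨0, 0, by simp, by simp, fun y => by simp [hit_zero_of_continuing hs]⟩
  | succ t =>
    have hprofile (z) : ∃ (p : ℝ≥0∞) (v : I → ℝ≥0∞), p ≤ 1 ∧ (∀ κ, v κ ≤ 1) ∧
        (M.moves (x ++ y₀) c z ≠ 0 → ∀ y,
          M.hit (x ++ y) h t (M.applyMove c z) ≤
            p + ∑ κ, v κ * M.value (x ++ y) h (dec κ) ∧
          p + ∑ κ, v κ * M.value (x ++ y) h (dec κ) ≤
            M.value (x ++ y) h (M.applyMove c z)) := by
      by_cases hz : M.moves (x ++ y₀) c z = 0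
      · exact ⟨0, 0, by simp, by simp, fun hz' => absurd hz hz'⟩
      · obtain ⟨p, v, hp, hv, hy⟩ := ih t t.lt_succ_self (hc.applyMove hs hz)
          ((M.applyMove_inPos_le c z).trans hi)
        exact ⟨p, v, hp, hv, fun _ => hy⟩
    choose p v hp hv hy using hprofile
    have hle_one {f : M.Q × HeadMove × M.Γ × HeadMove → ℝ≥0∞} (hf : ∀ z, f z ≤ 1) :
        ∑' z, M.moves (x ++ y₀) c z * f z ≤ 1 := by
      rw [← (M.moves (x ++ y₀) c).tsum_coe]
      exact ENNReal.tsum_le_tsum fun z => mul_le_of_le_one_right' (hf z)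
    refine ⟨∑' z, M.moves (x ++ y₀) c z * p z, fun κ => ∑' z, M.moves (x ++ y₀) c z * v z κ,
      hle_one hp, fun κ => hle_one fun z => hv z κ, fun y => ?_⟩
    have hm : M.moves (x ++ y) c = M.moves (x ++ y₀) c := by
      rw [moves, moves, inputAt_append_left y y₀ (Nat.lt_succ_iff.1 hi)]
    have hsum : (∑' z, M.moves (x ++ y₀) c z * p z) +
        ∑ κ, (∑' z, M.moves (x ++ y₀) c z * v z κ) * M.value (x ++ y) h (dec κ) =
        ∑' z, M.moves (x ++ y₀) c z * (p z + ∑ κ, v z κ * M.value (x ++ y) h (dec κ)) := by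
      simp only [mul_add, ENNReal.tsum_add, Finset.mul_sum]
      rw [Summable.tsum_finsetSum fun _ _ => ENNReal.summable]
      simp only [← ENNReal.tsum_mul_right, mul_assoc]
    rw [hsum, hit_succ_of_continuing hs, value_of_continuing hs, hm]
    constructor <;> refine ENNReal.tsum_le_tsum fun z => ?_ <;>
      rcases eq_or_ne (M.moves (x ++ y₀) c z) 0 with hz | hz
    · simp [hz]
    · exact mul_le_mul_right (hy z hz y).1 _
    · simp [hz]
    · exact mul_le_mul_right (hy z hz y).2 _

end PTM

/-! ### Counting distinguishable prefixes -/

/-- Vectors in a cube are few if they are separated by functionals with coefficients in `[0, 1]`: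
no two of them can be rounded to the same point of a sufficiently fine grid. -/
theorem card_le_of_separated {ι κ : Type*} [Fintype ι] [Fintype κ] (u g : ι → κ → ℝ)
    (hu0 : ∀ i k, 0 ≤ u i k) (hu1 : ∀ i k, u i k ≤ 1) (hg0 : ∀ i k, 0 ≤ g i k)
    (hg1 : ∀ i k, g i k ≤ 1) {δ : ℝ}
    (hsep : ∀ i j, i ≠ j → ∑ k, u j k * g i k + δ ≤ ∑ k, u i k * g i k) {m : ℕ} (hm : 0 < m)
    (hδ : Fintype.card κ < δ * m) : Fintype.card ι ≤ (m + 1) ^ Fintype.card κ := by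
  classical
  by_contra! hlt
  have hfloor (i k) : ⌊m * u i k⌋₊ < m + 1 := by
    rw [Nat.floor_lt (mul_nonneg m.cast_nonneg (hu0 i k))]
    push_cast
    nlinarith [hu1 i k, (Nat.cast_nonneg m : (0 : ℝ) ≤ m)]
  obtain ⟨i, j, hij, heq⟩ := Fintype.exists_ne_map_eq_of_card_lt
    (fun i k => (⟨⌊m * u i k⌋₊, hfloor i k⟩ : Fin (m + 1))) (by simpa using hlt)
  have hm' : (0 : ℝ) < m := by exact_mod_cast hm
  have hk (k) : m * (u i k * g i k) - m * (u j k * g i k) ≤ 1 := by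
    have h1 : ⌊m * u i k⌋₊ = ⌊m * u j k⌋₊ := congrArg Fin.val (congrFun heq k)
    have h2 := Nat.lt_floor_add_one (m * u i k)
    have h3 := Nat.floor_le (mul_nonneg hm'.le (hu0 j k))
    rw [h1] at h2
    have h4 : m * u i k - m * u j k ≤ 1 := by linarith
    nlinarith [hg0 i k, hg1 i k]
  have hsum := Finset.sum_le_sum fun k (_ : k ∈ Finset.univ) => hk k
  rw [Finset.sum_sub_distrib, ← Finset.mul_sum, ← Finset.mul_sum, Finset.sum_const,
    Finset.card_univ, nsmul_eq_mul, mul_one] at hsum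
  nlinarith [hsep i j hij]

namespace PTM

variable {A : Type} {M : PTM A StdHalt}

instance (n : ℕ) : Finite (M.WorkConfig n) := by
  have := M.finQ
  have := M.finΓ
  infer_instance

theorem natCard_workConfig (M : PTM A StdHalt) (n : ℕ) : Nat.card (M.WorkConfig n) =
    Nat.card M.Q * ((2 * n + 1) * Nat.card M.Γ ^ (2 * n + 1)) := by
  have h : (Finset.Icc (-n : ℤ) n).card = 2 * n + 1 := by
    rw [Int.card_Icc]
    omega
  rw [WorkConfig, Nat.card_prod, Nat.card_prod, Nat.card_fun, Nat.card_eq_finsetCard, h]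

/-- A one-way machine that accepts the words `x i ++ y i`, but not the words `x j ++ y i` with
`i ≠ j`, with bounded error has many work configurations if there are many words `x i`. -/
theorem IsOneWay.card_le {ι : Type*} [Fintype ι] (hM : M.IsOneWay) {s : ℕ → ℕ}
    (hs : M.UsesSpace s) {x y : ι → List A} {N n : ℕ} (hx : ∀ i, (x i).length = N)
    (hxy : ∀ i, (x i ++ y i).length = n) {ε : ℝ} (hε : ε < 1 / 2)
    (hacc : ∀ i, 1 - ε ≤ M.haltProb (x i ++ y i) .accept)
    (hrej : ∀ i j, i ≠ j → 1 - ε ≤ M.haltProb (x j ++ y i) .reject)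
    {m : ℕ} (hm : Nat.card (M.WorkConfig (s n)) + 1 < (1 / 2 - ε) * m) :
    Fintype.card ι ≤ (m + 1) ^ (Nat.card (M.WorkConfig (s n)) + 1) := by
  have := Fintype.ofFinite (M.WorkConfig (s n))
  have hfin {a : ℝ≥0∞} (ha : a ≤ 1) : a ≠ ⊤ := ne_top_of_le_ne_top ENNReal.one_ne_top ha
  -- `1 / 2` lies strictly below `1 - ε`, so that it is exceeded within finite time.
  have htime (i) : ∃ t, 1 / 2 ≤ (M.hit (x i ++ y i) .accept t M.init).toReal := by
    have h1 : ENNReal.ofReal (1 / 2) < M.value (x i ++ y i) .accept M.init := by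
      rw [ENNReal.ofReal_lt_iff_lt_toReal (by norm_num) (hfin (M.value_le_one ..))]
      exact lt_of_lt_of_le (by linarith) (hacc i)
    obtain ⟨t, ht⟩ := lt_iSup_iff.1 h1
    exact ⟨t, ((ENNReal.ofReal_lt_iff_lt_toReal (by norm_num)
      (hfin (toOuterMeasure_le_one _ _))).1 ht).le⟩
  choose t ht using htime
  let dec (κ : M.WorkConfig (s n)) : Config M.Q M.Γ := κ.toConfig (N + 1)
  have hprofile (i) := exists_profile (M := M) (h := .accept) (x i) (y i) dec
    (fun c hc hi => by
      obtain ⟨κ, hκ⟩ := hc.exists_toConfig_eq hs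
      revert κ
      rw [hi, hx, hxy]
      exact fun κ hκ => ⟨κ, hκ⟩)
    (t i) (M.reaches_init _) (Nat.zero_le _)
  choose p v hp hv hpv using hprofile
  -- The index `none` stands for halting inside the prefix.
  let u (i : ι) (k : Option (M.WorkConfig (s n))) : ℝ := (k.elim (p i) (v i)).toReal
  let g (i : ι) (k : Option (M.WorkConfig (s n))) : ℝ :=
    (k.elim 1 fun κ => M.value (x i ++ y i) .accept (dec κ)).toReal
  have hu (i) (k : Option (M.WorkConfig (s n))) : k.elim (p i) (v i) ≤ 1 := by
    cases k <;> simp [hp, hv]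
  have hg (i) (k : Option (M.WorkConfig (s n))) :
      k.elim 1 (fun κ => M.value (x i ++ y i) .accept (dec κ)) ≤ 1 := by
    cases k <;> simp [value_le_one]
  have hto {a : ℝ≥0∞} (ha : a ≤ 1) : a.toReal ≤ 1 :=
    ENNReal.toReal_le_of_le_ofReal zero_le_one (by simpa using ha)
  have hsum (i j) : ∑ k, u i k * g j k =
      (p i + ∑ κ, v i κ * M.value (x i ++ y j) .accept (dec κ)).toReal := by
    have hval (κ) : M.value (x i ++ y j) .accept (dec κ) =
        M.value (x j ++ y j) .accept (dec κ) :=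
      hM.value_append_congr (y j) ((hx i).trans (hx j).symm) (by rw [hx i]; exact le_rfl)
    have hfin' (κ) : v i κ * M.value (x j ++ y j) .accept (dec κ) ≠ ⊤ :=
      ENNReal.mul_ne_top (hfin (hv i κ)) (hfin (M.value_le_one ..))
    simp only [hval]
    rw [ENNReal.toReal_add (hfin (hp i)) (ENNReal.sum_ne_top.2 fun κ _ => hfin' κ),
      ENNReal.toReal_sum fun κ _ => hfin' κ, Fintype.sum_option]
    simp [u, g]
  have hcard : Fintype.card (Option (M.WorkConfig (s n))) = Nat.card (M.WorkConfig (s n)) + 1 := by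
    rw [Fintype.card_option, Nat.card_eq_fintype_card]
  have hm0 : 0 < m := by
    rcases m.eq_zero_or_pos with rfl | h
    · rw [Nat.cast_zero, mul_zero] at hm
      have : (0 : ℝ) ≤ Nat.card (M.WorkConfig (s n)) := Nat.cast_nonneg _
      linarith
    · exact h
  rw [← hcard]
  refine card_le_of_separated u g (fun i k => ENNReal.toReal_nonneg) (fun i k => hto (hu i k))
    (fun i k => ENNReal.toReal_nonneg) (fun i k => hto (hg i k)) (δ := 1 / 2 - ε)
    (fun i j hij => ?_) hm0 (by rw [hcard]; exact_mod_cast hm)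
  have h1 : (1 / 2 : ℝ) ≤ ∑ k, u i k * g i k := by
    rw [hsum]
    exact (ht i).trans (ENNReal.toReal_mono
      (hfin ((hpv i (y i)).2.trans (M.value_le_one ..))) (hpv i (y i)).1)
  have h2 : ∑ k, u j k * g i k ≤ M.haltProb (x j ++ y i) .accept := by
    rw [hsum]
    exact ENNReal.toReal_mono (hfin (M.value_le_one ..)) (hpv j (y i)).2
  have h3 := M.haltProb_add_haltProb_le_one (x j ++ y i) (h := .accept) (h' := .reject) (by simp)
  linarith [hrej i j hij]

end PTM

/-! ### Little space does not suffice without postselection -/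

open Filter

/-- A machine with `q` states, `g` work tape symbols and `o(log log n)` space has so few work
configurations on inputs of length `2 * N` that, for some `N`, a grid as fine as required in the
cube with one axis for each of them (and one more) has fewer than `N` points. -/
theorem exists_lt_of_isLittleOLogLog {s : ℕ → ℕ} (hs : IsLittleOLogLog s) {q g : ℕ} (hq : 0 < q)
    (hg : 0 < g) {δ : ℝ} (hδ : 0 < δ) : ∃ N m : ℕ,
      ((q * ((2 * s (2 * N) + 1) * g ^ (2 * s (2 * N) + 1)) : ℕ) : ℝ) + 1 < δ * m ∧
      (m + 1) ^ (q * ((2 * s (2 * N) + 1) * g ^ (2 * s (2 * N) + 1)) + 1) < N := by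
  -- With `K` the exponent and `m = ⌊K / δ⌋ + 1`, the proof bounds `K` by `C * C ^ s (2 * N)` and
  -- `m + 1` by `D * K`. So `log ((m + 1) ^ K) ≤ D * K ^ 2 ≤ D * C ^ 2 * (C ^ s (2 * N)) ^ 2`, and
  -- the last factor is at most the square root of `log (2 * N)` as soon as
  -- `s (2 * N) ≤ log (log (2 * N)) / (4 * log C)`.
  set C : ℝ := 8 * q * g ^ 2 with hC
  set D : ℝ := 1 / δ + 2 with hD
  have hq' : (1 : ℝ) ≤ q := by exact_mod_cast hq
  have hg' : (1 : ℝ) ≤ g := by exact_mod_cast hg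
  have hC8 : 8 ≤ C := by nlinarith [one_le_pow₀ hg' (n := 2)]
  have hlogC : 0 < Real.log C := Real.log_pos (by linarith)
  have hlog : Tendsto (fun N : ℕ => Real.log ((2 * N : ℕ) : ℝ)) atTop atTop :=
    Real.tendsto_log_atTop.comp (tendsto_natCast_atTop_atTop.comp
      (tendsto_id.const_mul_atTop' (by norm_num : 0 < 2)))
  have h2 : Tendsto (fun N : ℕ => 2 * N) atTop atTop :=
    tendsto_id.const_mul_atTop' (by norm_num : 0 < 2)
  have hsmall := h2.eventually (hs.def (show 0 < 1 / (4 * Real.log C) by positivity))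
  obtain ⟨N, hN, hNl, hN0⟩ := (hsmall.and ((hlog.eventually_gt_atTop
    ((D * C ^ 2 + 1) ^ 2)).and (eventually_gt_atTop 0))).exists
  set σ := s (2 * N) with hσ
  set K : ℕ := q * ((2 * σ + 1) * g ^ (2 * σ + 1)) + 1 with hK
  have hD0 : 0 < D := by positivity
  have hL : 1 < Real.log ((2 * N : ℕ) : ℝ) :=
    lt_of_le_of_lt (one_le_pow₀ (by nlinarith [sq_nonneg C])) hNl
  set L := Real.log ((2 * N : ℕ) : ℝ)
  have hσL : σ * (2 * Real.log C) ≤ Real.log L / 2 := by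
    rw [Real.norm_natCast, Real.norm_of_nonneg (Real.log_nonneg hL.le)] at hN
    calc σ * (2 * Real.log C) ≤ 1 / (4 * Real.log C) * Real.log L * (2 * Real.log C) := by gcongr
      _ = Real.log L / 2 := by field_simp; ring
  have hpow : (C ^ σ) ^ 2 ≤ Real.sqrt L := by
    rw [← Real.exp_log (show 0 < (C ^ σ) ^ 2 by positivity), Real.log_pow, Real.log_pow,
      ← Real.exp_log (show 0 < Real.sqrt L by positivity), Real.log_sqrt (by linarith)]
    apply Real.exp_le_exp.2
    push_cast
    linarith
  have hK1 : (1 : ℝ) ≤ K := by exact_mod_cast Nat.le_add_left 1 _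
  have hKC : (K : ℝ) ≤ C * C ^ σ := by
    have h1 : ((2 * σ + 1 : ℕ) : ℝ) ≤ 2 * 4 ^ σ := by
      have : 2 * σ + 1 ≤ 2 * 4 ^ σ :=
        Nat.lt_two_pow_self.le.trans_eq (by rw [pow_succ, pow_mul, mul_comm]; norm_num)
      exact_mod_cast this
    have h3 : (1 : ℝ) ≤ q * (2 * 4 ^ σ * g ^ (2 * σ + 1)) := by
      have : (1 : ℝ) ≤ 4 ^ σ := one_le_pow₀ (by norm_num)
      have : (1 : ℝ) ≤ g ^ (2 * σ + 1) := one_le_pow₀ hg'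
      nlinarith [mul_le_mul ‹(1 : ℝ) ≤ 4 ^ σ› this zero_le_one (by positivity)]
    calc (K : ℝ) = q * ((2 * σ + 1 : ℕ) * g ^ (2 * σ + 1)) + 1 := by rw [hK]; push_cast; ring
      _ ≤ q * (2 * 4 ^ σ * g ^ (2 * σ + 1)) + q * (2 * 4 ^ σ * g ^ (2 * σ + 1)) := by gcongr
      _ = 4 * q * g * (4 * g ^ 2) ^ σ := by rw [mul_pow, pow_succ, pow_mul]; ring
      _ ≤ C * C ^ σ := by
        gcongr
        · nlinarith [mul_le_mul hq' hg' zero_le_one (by linarith)]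
        · nlinarith [sq_nonneg (g : ℝ)]
  have hm := Nat.lt_floor_add_one (K / δ)
  refine ⟨N, ⌊K / δ⌋₊ + 1, ?_, ?_⟩
  · rw [div_lt_iff₀ hδ] at hm
    rw [mul_comm δ]
    rw [hK] at hm ⊢
    exact_mod_cast hm
  · have hmD : ((⌊K / δ⌋₊ + 1 + 1 : ℕ) : ℝ) ≤ D * K := by
      have := Nat.floor_le (show 0 ≤ K / δ by positivity)
      push_cast
      rw [hD, add_mul, one_div_mul_eq_div]
      linarith
    have hN' : (0 : ℝ) < N := by exact_mod_cast hN0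
    have hLN : L ≤ Real.log N + 1 := by
      rw [show L = Real.log (2 * N) by simp [L], Real.log_mul (by norm_num) hN'.ne']
      linarith [Real.log_two_lt_d9]
    have hr : (D * C ^ 2 + 1) < Real.sqrt L := Real.lt_sqrt_of_sq_lt hNl
    have hbound : (K : ℝ) * (D * K) < Real.log N := by
      calc (K : ℝ) * (D * K) = D * K ^ 2 := by ring
        _ ≤ D * (C * C ^ σ) ^ 2 := by gcongr
        _ = D * C ^ 2 * (C ^ σ) ^ 2 := by ring
        _ ≤ D * C ^ 2 * Real.sqrt L := by gcongr
        _ < Real.log N := by nlinarith [Real.sq_sqrt (show 0 ≤ L by linarith), sq_nonneg C]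
    have hfinal : ((⌊K / δ⌋₊ + 1 + 1 : ℕ) : ℝ) ^ K < N := by
      calc ((⌊K / δ⌋₊ + 1 + 1 : ℕ) : ℝ) ^ K ≤ (D * K) ^ K := by gcongr
        _ ≤ Real.exp (D * K) ^ K := by
          gcongr
          linarith [Real.add_one_le_exp (D * K)]
        _ = Real.exp (K * (D * K)) := by rw [← Real.exp_nat_mul]
        _ < Real.exp (Real.log N) := Real.exp_lt_exp.2 hbound
        _ = N := Real.exp_log hN'
    exact_mod_cast hfinal

/-- The prefixes `aⁱ bᴺ⁻ⁱ` with `i < N` need pairwise different continuations: `aⁱ bᴺ⁻ⁱ` followed by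
`aᴺ⁻ʲ bʲ` has equal letter counts only if `i = j`. All these inputs have length `2 * N`, so the
space bound enters only through its value at `2 * N`. -/
theorem equalCounts_notMem_oneWayBPSPACE {A : Type} {a b : A} (hab : a ≠ b) {s : ℕ → ℕ}
    (hs : IsLittleOLogLog s) : equalCounts a b ∉ OneWayBPSPACE A s := by
  classical
  rintro ⟨M, hM, hMs, ε, -, hε, hacc, hrej⟩
  have := M.finQ
  have := M.finΓ
  have : Nonempty M.Q := ⟨M.start⟩
  have : Nonempty M.Γ := ⟨M.blank⟩
  obtain ⟨N, m, hm, hN⟩ := exists_lt_of_isLittleOLogLog hs (Nat.card_pos (α := M.Q))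
    (Nat.card_pos (α := M.Γ)) (show 0 < 1 / 2 - ε by linarith)
  rw [← PTM.natCard_workConfig] at hm hN
  let x (i : Fin N) : List A := List.replicate i a ++ List.replicate (N - i) b
  let y (i : Fin N) : List A := List.replicate (N - i) a ++ List.replicate i b
  have hmem (i j : Fin N) : x i ++ y j ∈ equalCounts a b ↔ i = j := by
    change (x i ++ y j).count a = (x i ++ y j).count b ↔ i = j
    simp only [x, y, List.count_append, List.count_replicate, beq_iff_eq, hab, hab.symm, if_true,
      if_false, Fin.ext_iff]
    omega
  have hcard := hM.card_le hMs (x := x) (y := y) (N := N) (n := 2 * N)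
    (fun i => by simp [x]) (fun i => by simp [x, y]; omega) hε
    (fun i => hacc _ ((hmem i i).2 rfl)) (fun i j hij => hrej _ (by rw [hmem]; exact hij.symm)) hm
  rw [Fintype.card_fin] at hcard
  omega

theorem isLittleOLogLog_one : IsLittleOLogLog fun _ => 1 := by
  have h : Tendsto (fun n : ℕ => Real.log (Real.log n)) atTop atTop :=
    Real.tendsto_log_atTop.comp (Real.tendsto_log_atTop.comp tendsto_natCast_atTop_atTop)
  refine Asymptotics.isLittleO_const_left.2 (Or.inr ?_)
  exact tendsto_norm_atTop_atTop.comp h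

theorem mainTheorem3 (A : Type) [Finite A] :
    (OneWayBPSPACELittleOLogLog A ⊆ PostOneWayBPSPACELittleOLogLog A ∧
      (Nontrivial A → OneWayBPSPACELittleOLogLog A ⊂ PostOneWayBPSPACELittleOLogLog A)) ∧
    (∀ s : ℕ → ℕ, IsLittleOLogLog s → (∀ n, 1 ≤ s n) →
      OneWayBPSPACE A s ⊆ PostOneWayBPSPACE A s ∧
        (Nontrivial A → OneWayBPSPACE A s ⊂ PostOneWayBPSPACE A s)) := by
  have hsub : OneWayBPSPACELittleOLogLog A ⊆ PostOneWayBPSPACELittleOLogLog A :=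
    fun L ⟨s, hs, hL⟩ => ⟨s, hs, oneWayBPSPACE_subset_postOneWayBPSPACE A s hL⟩
  refine ⟨⟨hsub, fun _ => ?_⟩,
    fun s hs hs1 => ⟨oneWayBPSPACE_subset_postOneWayBPSPACE A s, fun _ => ?_⟩⟩
  · obtain ⟨a, b, hab⟩ := exists_pair_ne A
    refine ssubset_of_subset_not_subset hsub fun h => ?_
    obtain ⟨s, hs, hL⟩ := h ⟨fun _ => 1, isLittleOLogLog_one,
      equalCounts_mem_postOneWayBPSPACE hab fun _ => le_rfl⟩
    exact equalCounts_notMem_oneWayBPSPACE hab hs hL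
  · obtain ⟨a, b, hab⟩ := exists_pair_ne A
    exact ssubset_of_subset_not_subset (oneWayBPSPACE_subset_postOneWayBPSPACE A s) fun h =>
      equalCounts_notMem_oneWayBPSPACE hab hs (h (equalCounts_mem_postOneWayBPSPACE hab hs1))

end
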